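/- Let $H$, $L$ be profinite groups, let $K$ be a finite group embedded as a common subgroup in both $H$ and $L$, and let $G = H \amalg_K L$ be their profinite amalgamated product, that is, the pushout of $H \leftarrow K \rightarrow L$ in the category of profinite groups and continuous homomorphisms. Let $R$ be a finite (unital, associative) ring in which $|K| \cdot 1_R \neq 0$. Let $R[[G]] = \varprojlim_U R[G/U]$ be the completed group algebra, where $U$ runs over the open normal subgroups of $G$, equipped with the inverse limit topology of the finite discrete rings $R[G/U]$. Then there exists a continuous right derivation $f \colon G \to R[[G]]$, i.e. a continuous map satisfying $f(gh) = f(g)h + f(h)$ for all $g, h \in G$, whose kernel $\operatorname{Ker}(f) = \{g \in G : f(g) = 0\}$ is exactly $H$ (identified with its image under the canonical map $H \to G$). -/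

import Mathlib

universe u v

section CompletedGroupAlgebra

variable (R G : Type*) [Ring R] [Group G] [TopologicalSpace G]

/-- For open normal subgroups `U ≤ V`, the ring homomorphism `R[G/U] → R[G/V]` induced by the
canonical projection `G/U → G/V`. -/
noncomputable def groupAlgebraTransition {U V : OpenNormalSubgroup G} (h : U ≤ V) :
    MonoidAlgebra R (G ⧸ U.toSubgroup) →+* MonoidAlgebra R (G ⧸ V.toSubgroup) :=
  MonoidAlgebra.mapDomainRingHom R
    (QuotientGroup.map U.toSubgroup V.toSubgroup (MonoidHom.id G) h)

/-- The subring of `∏ U, R[G/U]` formed by the compatible families. -/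
def compatibleFamilies :
    Subring ((U : OpenNormalSubgroup G) → MonoidAlgebra R (G ⧸ U.toSubgroup)) where
  carrier := {x | ∀ (U V : OpenNormalSubgroup G) (h : U ≤ V),
    groupAlgebraTransition R G h (x U) = x V}
  mul_mem' {x y} hx hy U V h := by
    simp only [Pi.mul_apply, map_mul, hx U V h, hy U V h]
  one_mem' U V h := by simp only [Pi.one_apply, map_one]
  add_mem' {x y} hx hy U V h := by
    simp only [Pi.add_apply, map_add, hx U V h, hy U V h]
  zero_mem' U V h := by simp only [Pi.zero_apply, map_zero]
  neg_mem' {x} hx U V h := by simp only [Pi.neg_apply, map_neg, hx U V h]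

/-- The completed group algebra `R[[G]]` of a profinite group `G` over a finite ring `R`: the
inverse limit of the group algebras `R[G/U]`, where `U` runs over the open normal subgroups
of `G`. -/
def CompletedGroupAlgebra : Type _ := compatibleFamilies R G

namespace CompletedGroupAlgebra

noncomputable instance : Ring (CompletedGroupAlgebra R G) :=
  inferInstanceAs (Ring (compatibleFamilies R G))

/-- The projection `R[[G]] → R[G/U]`. -/
noncomputable def proj (U : OpenNormalSubgroup G) :
    CompletedGroupAlgebra R G →+* MonoidAlgebra R (G ⧸ U.toSubgroup) :=
  (Pi.evalRingHom _ U).comp (compatibleFamilies R G).subtype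

/-- The inverse limit topology, each `R[G/U]` being discrete (for `R` finite and `G` profinite,
`R[G/U]` is a finite ring). -/
noncomputable instance : TopologicalSpace (CompletedGroupAlgebra R G) :=
  ⨅ U : OpenNormalSubgroup G, TopologicalSpace.induced (proj R G U) ⊥

/-- The canonical map `G → R[[G]]`, with components `g ↦ gU ∈ R[G/U]`. -/
noncomputable def of : G →* CompletedGroupAlgebra R G where
  toFun g := ⟨fun U => MonoidAlgebra.of R (G ⧸ U.toSubgroup) (g : G ⧸ U.toSubgroup), by
    intro U V h
    simp only [groupAlgebraTransition, MonoidAlgebra.of_apply,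
      MonoidAlgebra.mapDomainRingHom_apply, MonoidAlgebra.mapDomain_single]
    rfl⟩
  map_one' := Subtype.ext (funext fun _ => map_one _)
  map_mul' g h := Subtype.ext (funext fun U => by
    change MonoidAlgebra.of R (G ⧸ U.toSubgroup) ((g * h : G) : G ⧸ U.toSubgroup) =
      MonoidAlgebra.of R (G ⧸ U.toSubgroup) (g : G ⧸ U.toSubgroup) *
        MonoidAlgebra.of R (G ⧸ U.toSubgroup) (h : G ⧸ U.toSubgroup)
    rw [← map_mul]
    rfl)

/-- `R[[G]]` as a right `G`-module: `x · g` is the product of `x` with the image of `g` in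
`R[[G]]`. A right action of `G` is a left action of `Gᵐᵒᵖ`. -/
noncomputable instance : DistribMulAction Gᵐᵒᵖ (CompletedGroupAlgebra R G) where
  smul g x := x * of R G g.unop
  one_smul x := by
    change x * of R G 1 = x
    rw [map_one, mul_one]
  mul_smul g h x := by
    change x * of R G (h.unop * g.unop) = x * of R G h.unop * of R G g.unop
    rw [map_mul, mul_assoc]
  smul_zero g := zero_mul _
  smul_add g x y := add_mul _ _ _

end CompletedGroupAlgebra

end CompletedGroupAlgebra

/-- A right derivation of a group `G` in a right `G`-module `M`: a map `f : G → M` with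
`f (g h) = f (g) · h + f (h)` for all `g` and `h`. -/
def IsRightDerivation {G M : Type*} [Group G] [AddCommGroup M] [DistribMulAction Gᵐᵒᵖ M]
    (f : G → M) : Prop :=
  ∀ g h : G, f (g * h) = MulOpposite.op h • f g + f h

/-- `G = H ⨿_K L` is a profinite amalgamated product, with structure maps `i : K → H`,
`j : K → L`, `a : H → G` and `b : L → G`: the homomorphisms `i` and `j` embed `K` as a common
subgroup of `H` and `L`, and `G` is the pushout of `H` and `L` over `K` in the category of
profinite groups and continuous homomorphisms. -/
structure IsProfiniteAmalgam {K H L G : ProfiniteGrp.{u}} (i : K ⟶ H) (j : K ⟶ L) (a : H ⟶ G)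
    (b : L ⟶ G) : Prop where
  injective_left : Function.Injective i
  injective_right : Function.Injective j
  isPushout : CategoryTheory.IsPushout i j a b

open CategoryTheory

/-! Put `E = ∑ k ∈ K, k`. Since `E k = E`, the zero derivation on `H` and the inner derivation `l ↦
E (l - 1)` on `L` agree on `K`, so they glue to a derivation `f` of `G`. The gluing is done in each
finite ring `R[G/U]` by encoding derivations as affine actions (`exists_derivation`); the levels are
compatible because a continuous derivation is determined on the factors (`derivation_ext`).

For the kernel, let `N` be the sum of the elements of the image of `H` in `G/U`. Both `N f` and the
inner derivation `g ↦ |K| N (g - 1)` vanish on `H`, and they agree on `L` because `N E = |K| N`;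
hence they are equal. If `f g = 0`, then `|K| N (g - 1) = 0`, and `|K| ≠ 0` in `R` forces `gU` into
the image of `H`. This holds for every `U`, and the image of `H` is closed in `G`, so `g` lies in
it. -/

/-- The action of a group on a ring by right multiplication with inverses, along a homomorphism to
the multiplicative monoid of the ring. -/
def mulRightInvPerm {A M : Type*} [Ring A] [Group M] (π : M →* A) : M →* Equiv.Perm A where
  toFun g :=
    { toFun := fun m => m * π g⁻¹
      invFun := fun m => m * π g
      left_inv := fun m => by beta_reduce; rw [mul_assoc, ← map_mul, inv_mul_cancel, map_one, mul_one]
      right_inv := fun m => by beta_reduce; rw [mul_assoc, ← map_mul, mul_inv_cancel, map_one, mul_one] }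
  map_one' := Equiv.ext fun m => by simp
  map_mul' g h := Equiv.ext fun m => by simp [mul_assoc]

/-! ### Generation, lifting and gluing of derivations for amalgams. -/

namespace IsProfiniteAmalgam

variable {K H L G : ProfiniteGrp.{u}} {i : K ⟶ H} {j : K ⟶ L} {a : H ⟶ G} {b : L ⟶ G}

theorem comm_apply (hG : IsProfiniteAmalgam i j a b) (k : K) : a (i k) = b (j k) := by
  simpa using ConcreteCategory.congr_hom hG.isPushout.w k

/-- A profinite amalgamated product is topologically generated by its factors. -/
theorem mem_of_isClosed (hG : IsProfiniteAmalgam i j a b) (P : Subgroup G)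
    (hP : IsClosed (P : Set G)) (ha : ∀ h, a h ∈ P) (hb : ∀ l, b l ∈ P) (g : G) : g ∈ P := by
  have : CompactSpace P := isCompact_iff_compactSpace.mp hP.isCompact
  let φ : H ⟶ ProfiniteGrp.of P := ConcreteCategory.ofHom
    { toMonoidHom := a.hom.toMonoidHom.codRestrict P ha
      continuous_toFun := a.hom.continuous_toFun.subtype_mk _ }
  let ψ : L ⟶ ProfiniteGrp.of P := ConcreteCategory.ofHom
    { toMonoidHom := b.hom.toMonoidHom.codRestrict P hb
      continuous_toFun := b.hom.continuous_toFun.subtype_mk _ }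
  let ι : ProfiniteGrp.of P ⟶ G := ConcreteCategory.ofHom
    { toMonoidHom := P.subtype
      continuous_toFun := continuous_subtype_val }
  have hw : i ≫ φ = j ≫ ψ :=
    ConcreteCategory.hom_ext _ _ fun k => Subtype.ext (hG.comm_apply k)
  -- The factors land in `P`, so they induce `G ⟶ P`; by uniqueness its composite with the inclusion
  -- is the identity.
  have hid : hG.isPushout.desc φ ψ hw ≫ ι = 𝟙 G := by
    apply hG.isPushout.hom_ext
    · rw [IsPushout.inl_desc_assoc, Category.comp_id]; rfl
    · rw [IsPushout.inr_desc_assoc, Category.comp_id]; rfl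
  have h := ConcreteCategory.congr_hom hid g
  have h' : ((hG.isPushout.desc φ ψ hw g : P) : G) = g := h
  exact h' ▸ (hG.isPushout.desc φ ψ hw g : P).2

/-- The universal property with respect to finite groups in an arbitrary universe. -/
theorem exists_lift (hG : IsProfiniteAmalgam i j a b) {Γ : Type*} [Group Γ] [Finite Γ]
    [TopologicalSpace Γ] [DiscreteTopology Γ] (φ : H →ₜ* Γ) (ψ : L →ₜ* Γ)
    (h : ∀ k, φ (i k) = ψ (j k)) :
    ∃ χ : G →ₜ* Γ, (∀ x, χ (a x) = φ x) ∧ ∀ x, χ (b x) = ψ x := by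
  -- The pushout only tests against groups in universe `u`, so `Γ` is replaced by a small copy.
  let e : Shrink.{u} Γ ≃* Γ := Shrink.mulEquiv
  let : TopologicalSpace (Shrink.{u} Γ) := ⊥
  have : DiscreteTopology (Shrink.{u} Γ) := ⟨rfl⟩
  have : Finite (Shrink.{u} Γ) := Finite.of_equiv Γ e.symm.toEquiv
  have : IsTopologicalGroup (Shrink.{u} Γ) := {}
  let e₁ : Γ →ₜ* Shrink.{u} Γ := ⟨e.symm.toMonoidHom, continuous_of_discreteTopology⟩
  let e₂ : Shrink.{u} Γ →ₜ* Γ := ⟨e.toMonoidHom, continuous_of_discreteTopology⟩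
  let φ' : H ⟶ ProfiniteGrp.of (Shrink.{u} Γ) := ConcreteCategory.ofHom (e₁.comp φ)
  let ψ' : L ⟶ ProfiniteGrp.of (Shrink.{u} Γ) := ConcreteCategory.ofHom (e₁.comp ψ)
  have hw : i ≫ φ' = j ≫ ψ' :=
    ConcreteCategory.hom_ext _ _ fun k => congrArg e.symm (h k)
  refine ⟨e₂.comp (hG.isPushout.desc φ' ψ' hw).hom, fun x => ?_, fun x => ?_⟩
  · have := ConcreteCategory.congr_hom (hG.isPushout.inl_desc φ' ψ' hw) x
    exact (congrArg e this).trans (e.apply_symm_apply _)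
  · have := ConcreteCategory.congr_hom (hG.isPushout.inr_desc φ' ψ' hw) x
    exact (congrArg e this).trans (e.apply_symm_apply _)

section Derivation

variable {A : Type*} [Ring A] [TopologicalSpace A] [DiscreteTopology A]

/-- A continuous derivation of an amalgamated product is determined by its values on the
factors. -/
theorem derivation_ext (hG : IsProfiniteAmalgam i j a b) (π : G →* A) {f f' : G → A}
    (hfc : Continuous f) (hfc' : Continuous f')
    (hf : ∀ g h, f (g * h) = f g * π h + f h) (hf' : ∀ g h, f' (g * h) = f' g * π h + f' h)
    (ha : ∀ x, f (a x) = f' (a x)) (hb : ∀ x, f (b x) = f' (b x)) (g : G) : f g = f' g := by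
  have hone : ∀ {f : G → A}, (∀ g h, f (g * h) = f g * π h + f h) → f 1 = 0 := by
    intro f hf
    simpa using hf 1 1
  have hinv : ∀ {f : G → A}, (∀ g h, f (g * h) = f g * π h + f h) →
      ∀ g, f g⁻¹ = -(f g * π g⁻¹) := by
    intro f hf g
    have := hf g g⁻¹
    rw [mul_inv_cancel, hone hf] at this
    exact (neg_eq_of_add_eq_zero_right this.symm).symm
  let P : Subgroup G :=
    { carrier := {g | f g = f' g}
      mul_mem' := fun {x y} hx hy => by
        change f (x * y) = f' (x * y)
        rw [hf, hf', show f x = f' x from hx, show f y = f' y from hy]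
      one_mem' := (hone hf).trans (hone hf').symm
      inv_mem' := fun {x} hx => by
        change f x⁻¹ = f' x⁻¹
        rw [hinv hf, hinv hf', show f x = f' x from hx] }
  exact hG.mem_of_isClosed P (isClosed_eq hfc hfc') ha hb g

/-- Given `e` fixed by `K`, the derivations `0` on `H` and `l ↦ e (l - 1)` on `L` glue. -/
theorem exists_derivation (hG : IsProfiniteAmalgam i j a b) [Finite A] (π : G →* A)
    (hπ : Continuous π) (e : A) (he : ∀ k, e * π (a (i k)) = e) :
    ∃ f : G → A, Continuous f ∧ (∀ g h, f (g * h) = f g * π h + f h) ∧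
      (∀ x, f (a x) = 0) ∧ ∀ x, f (b x) = e * (π (b x) - 1) := by
  let : TopologicalSpace (Equiv.Perm A) := ⊥
  have : DiscreteTopology (Equiv.Perm A) := ⟨rfl⟩
  have hc : Continuous (mulRightInvPerm π) := by
    have h : ∀ g g' : G, π g = π g' → mulRightInvPerm π g = mulRightInvPerm π g' := by
      intro g g' hg
      apply inv_injective
      exact Equiv.ext fun m => congrArg (m * ·) hg
    have : IsLocallyConstant (mulRightInvPerm π) := by
      rw [IsLocallyConstant.iff_exists_open]
      intro x
      exact ⟨π ⁻¹' {π x}, (isOpen_discrete _).preimage hπ, rfl, fun y hy => h y x hy⟩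
    exact this.continuous
  let ρ : G →ₜ* Equiv.Perm A := ⟨mulRightInvPerm π, hc⟩
  -- Conjugating by translation by `e` moves the fixed point `0` of the linear action to `-e`, which
  -- adds an inner derivation. On `K` nothing changes, because `e` is `K`-fixed.
  let σ : Equiv.Perm A →ₜ* Equiv.Perm A :=
    ⟨(MulAut.conj (Equiv.addRight (-e))).toMonoidHom, continuous_of_discreteTopology⟩
  have hσ : ∀ g m, σ (ρ g) m = (m + e) * π g⁻¹ - e := by
    intro g m
    change (Equiv.addRight (-e)) (ρ g ((Equiv.addRight (-e))⁻¹ m)) = _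
    rw [Equiv.Perm.inv_def, Equiv.addRight_symm, Equiv.coe_addRight, Equiv.coe_addRight, neg_neg,
      sub_eq_add_neg]
    rfl
  obtain ⟨χ, hχa, hχb⟩ := hG.exists_lift (ρ.comp a.hom) ((σ.comp ρ).comp b.hom) (by
    intro k
    refine Equiv.ext fun m => ?_
    change ρ (a (i k)) m = σ (ρ (b (j k))) m
    rw [hσ, ← hG.comm_apply, add_mul, ← map_inv, ← map_inv, he, add_sub_cancel_right, map_inv,
      map_inv]
    rfl)
  have hχa' : ∀ x m, χ (a x) m = m * π (a x)⁻¹ := fun x m => by rw [hχa]; rfl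
  have hχb' : ∀ x m, χ (b x) m = (m + e) * π (b x)⁻¹ - e := fun x m => by
    rw [hχb, ← hσ]; rfl
  -- Having linear part `m ↦ m * π g⁻¹` is a closed condition, stable under products and inverses,
  -- so it suffices to check it on the factors.
  have haff : ∀ (g : G) (m : A), χ g m = m * π g⁻¹ + χ g 0 := by
    let P : Subgroup G :=
      { carrier := {g | ∀ m, χ g m = m * π g⁻¹ + χ g 0}
        mul_mem' := fun {x y} hx hy m => by
          rw [map_mul, Equiv.Perm.mul_apply, Equiv.Perm.mul_apply, hx (χ y m), hy m,
            hx (χ y 0), mul_inv_rev, map_mul, add_mul, mul_assoc, add_assoc]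
        one_mem' := fun m => by simp
        inv_mem' := fun {x} hx m => by
          have hs (m : A) : χ x (χ x⁻¹ m) = m := by
            rw [← Equiv.Perm.mul_apply, ← map_mul, mul_inv_cancel, map_one, Equiv.Perm.one_apply]
          apply (χ x).injective
          rw [hx (_ + _), hs, add_mul, mul_assoc, ← map_mul, inv_inv, mul_inv_cancel, map_one,
            mul_one, add_assoc, ← hx, hs, add_zero] }
    refine hG.mem_of_isClosed P ?_ ?_ ?_
    · have : (P : Set G) = ⋂ m, {g | χ g m = m * π g⁻¹ + χ g 0} := by
        ext g; simp [P]
      rw [this]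
      refine isClosed_iInter fun m => isClosed_eq ?_ ?_
      · exact (continuous_of_discreteTopology (f := fun p : Equiv.Perm A => p m)).comp
          χ.continuous_toFun
      · exact (continuous_of_discreteTopology (f := fun p : A × Equiv.Perm A =>
          m * p.1 + p.2 0)).comp ((hπ.comp continuous_inv).prodMk χ.continuous_toFun)
    · intro x m
      rw [hχa', hχa', zero_mul, add_zero]
    · intro x m
      rw [hχb', hχb', zero_add, add_mul, add_sub_assoc]
  -- The translation part is the derivation; the inverse converts the left action into a right
  -- derivation.
  refine ⟨fun g => χ g⁻¹ 0, ?_, fun g h => ?_, fun x => ?_, fun x => ?_⟩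
  · exact (continuous_of_discreteTopology (f := fun p : Equiv.Perm A => p 0)).comp
      (χ.continuous_toFun.comp continuous_inv)
  · change χ (g * h)⁻¹ 0 = χ g⁻¹ 0 * π h + χ h⁻¹ 0
    rw [mul_inv_rev, map_mul, Equiv.Perm.mul_apply, haff, inv_inv]
  · change χ (a x)⁻¹ 0 = 0
    rw [← map_inv, hχa', zero_mul]
  · change χ (b x)⁻¹ 0 = _
    rw [← map_inv, hχb', ← map_inv, inv_inv, zero_add, mul_sub, mul_one]

end Derivation

end IsProfiniteAmalgam

/-! ### Subgroup sums in group algebras. -/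

namespace MonoidAlgebra

variable {R Q : Type*} [Ring R] [Group Q]

instance [Finite R] [Finite Q] : Finite (MonoidAlgebra R Q) :=
  Finite.of_equiv _ (coeffEquiv.trans Finsupp.equivFunOnFinite).symm

variable (R) in
/-- The sum of the elements of a finite subgroup, in the group algebra. -/
noncomputable def subgroupSum (S : Subgroup Q) [Fintype S] : MonoidAlgebra R Q :=
  ∑ s : S, of R Q s

theorem subgroupSum_mul_of (S : Subgroup Q) [Fintype S] {q : Q} (hq : q ∈ S) :
    subgroupSum R S * of R Q q = subgroupSum R S := by
  rw [subgroupSum, Finset.sum_mul]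
  refine Fintype.sum_equiv (Equiv.mulRight (⟨q, hq⟩ : S)) _ _ fun s => ?_
  rw [← map_mul]
  rfl

theorem coeff_subgroupSum_of_notMem (S : Subgroup Q) [Fintype S] {q : Q} (hq : q ∉ S) :
    (subgroupSum R S).coeff q = 0 := by
  classical
  rw [subgroupSum, coeff_sum, Finsupp.finsetSum_apply]
  refine Finset.sum_eq_zero fun s _ => ?_
  rw [of_apply, coeff_single, Finsupp.single_apply, if_neg]
  rintro rfl
  exact hq s.2

theorem coeff_subgroupSum_mul_of (S : Subgroup Q) [Fintype S] (q : Q) :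
    (subgroupSum R S * of R Q q).coeff q = 1 := by
  classical
  rw [subgroupSum, Finset.sum_mul, coeff_sum, Finsupp.finsetSum_apply,
    Finset.sum_eq_single (1 : S)]
  · simp
  · intro s _ hs
    rw [← map_mul, of_apply, coeff_single, Finsupp.single_apply, if_neg]
    simpa using hs
  · simp

/-- If `n ≠ 0` in `R` and `n • N_S (q - 1) = 0`, where `N_S` is the sum of the elements of the
subgroup `S`, then `q ∈ S`. -/
theorem mem_of_nsmul_subgroupSum_mul_eq_zero (S : Subgroup Q) [Fintype S] {q : Q} {n : ℕ}
    (hn : (n : R) ≠ 0) (h : n • (subgroupSum R S * (of R Q q - 1)) = 0) : q ∈ S := by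
  by_contra hq
  apply hn
  rw [mul_sub, mul_one, nsmul_sub, sub_eq_zero] at h
  -- At `q`, the coefficient of `N_S q` is `1` and that of `N_S` is `0`, leaving `n = 0` in `R`.
  have h' := congrArg (fun x : MonoidAlgebra R Q => x.coeff q) h
  simpa only [coeff_smul, Finsupp.smul_apply, coeff_subgroupSum_of_notMem S hq,
    coeff_subgroupSum_mul_of S q, smul_zero, nsmul_one] using h'

end MonoidAlgebra

/-! ### Passage between `G` and its finite quotients. -/

/-- A point outside a closed subgroup can be separated from it by a finite quotient. -/
theorem ProfiniteGrp.mem_of_isClosed_of_forall_mem_map (G : ProfiniteGrp.{u}) (P : Subgroup G)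
    (hP : IsClosed (P : Set G)) (g : G)
    (h : ∀ U : OpenNormalSubgroup G,
      (g : G ⧸ U.toSubgroup) ∈ P.map (QuotientGroup.mk' U.toSubgroup)) : g ∈ P := by
  by_contra hg
  have hW : IsOpen ((fun x => g * x) ⁻¹' (P : Set G)ᶜ) :=
    hP.isOpen_compl.preimage (continuous_const_mul g)
  obtain ⟨U, hU⟩ := ProfiniteGrp.exist_openNormalSubgroup_sub_open_nhds_of_one hW (by simpa)
  obtain ⟨p, hp, hpg⟩ := h U
  have : g⁻¹ * p ∈ U.toSubgroup := QuotientGroup.eq.mp hpg.symm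
  exact hU this (by simpa using hp)

namespace CompletedGroupAlgebra

variable {R G : Type*} [Ring R] [Group G] [TopologicalSpace G]

theorem transition_proj {U V : OpenNormalSubgroup G} (h : U ≤ V) (x : CompletedGroupAlgebra R G) :
    groupAlgebraTransition R G h (proj R G U x) = proj R G V x :=
  x.2 U V h

theorem proj_of (U : OpenNormalSubgroup G) (g : G) :
    proj R G U (of R G g) = MonoidAlgebra.of R (G ⧸ U.toSubgroup) (g : G ⧸ U.toSubgroup) :=
  rfl

end CompletedGroupAlgebra

open CompletedGroupAlgebra in
theorem mainTheorem3 {K H L G : ProfiniteGrp.{u}} (i : K ⟶ H) (j : K ⟶ L) (a : H ⟶ G)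
    (b : L ⟶ G) (hG : IsProfiniteAmalgam i j a b) [Finite K]
    (R : Type v) [Ring R] [Finite R] (hR : (Nat.card K : R) ≠ 0) :
    ∃ f : G → CompletedGroupAlgebra R G,
      Continuous f ∧ IsRightDerivation f ∧ {g : G | f g = 0} = Set.range a := by
  classical
  let (U : OpenNormalSubgroup G) : TopologicalSpace (MonoidAlgebra R (G ⧸ U.toSubgroup)) := ⊥
  have (U : OpenNormalSubgroup G) : DiscreteTopology (MonoidAlgebra R (G ⧸ U.toSubgroup)) := ⟨rfl⟩
  have (U : OpenNormalSubgroup G) : Finite (G ⧸ U.toSubgroup) :=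
    U.toSubgroup.quotient_finite_of_isOpen U.isOpen'
  have := Fintype.ofFinite K
  let π (U : OpenNormalSubgroup G) : G →* MonoidAlgebra R (G ⧸ U.toSubgroup) :=
    ((proj R G U : _ →* _)).comp (of R G)
  have hπ (U : OpenNormalSubgroup G) : Continuous (π U) := by
    have : DiscreteTopology (G ⧸ U.toSubgroup) :=
      inferInstanceAs (DiscreteTopology (G ⧸ U.toOpenSubgroup.toSubgroup))
    exact (continuous_of_discreteTopology (f := MonoidAlgebra.of R (G ⧸ U.toSubgroup))).comp
      continuous_quot_mk
  -- The sum is indexed by `K` itself, not by its image in `G`, so the factor `|K|` appears below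
  -- even without injectivity of `K → G`.
  let E : CompletedGroupAlgebra R G := ∑ k : K, of R G (a (i k))
  have hE (k : K) : E * of R G (a (i k)) = E := by
    rw [Finset.sum_mul]
    refine Fintype.sum_equiv (Equiv.mulRight k) _ _ fun k' => ?_
    rw [Equiv.coe_mulRight, map_mul, map_mul, map_mul]
  choose F hFc hF hFa hFb using fun U => hG.exists_derivation (π U) (hπ U) (proj R G U E)
    fun k => by
      change proj R G U E * proj R G U (of R G (a (i k))) = _
      rw [← map_mul, hE]
  have hcompat (g : G) (U V : OpenNormalSubgroup G) (h : U ≤ V) :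
      groupAlgebraTransition R G h (F U g) = F V g := by
    have hT (g : G) : groupAlgebraTransition R G h (π U g) = π V g := transition_proj h (of R G g)
    refine hG.derivation_ext (π V) (f := fun g => groupAlgebraTransition R G h (F U g))
      (continuous_of_discreteTopology.comp (hFc U)) (hFc V) (fun x y => ?_) (hF V)
      (fun x => ?_) (fun x => ?_) g
    · rw [hF, map_add, map_mul, hT]
    · rw [hFa, hFa, map_zero]
    · rw [hFb, hFb, map_mul, map_sub, map_one, hT, transition_proj]
  let f (g : G) : CompletedGroupAlgebra R G := ⟨fun U => F U g, hcompat g⟩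
  have hf (x : H) : f (a x) = 0 := Subtype.ext (funext fun U => hFa U x)
  refine ⟨f, ?_, fun g h => Subtype.ext (funext fun U => hF U g h), ?_⟩
  · exact continuous_iInf_rng.2 fun U => continuous_induced_rng.2 (hFc U)
  refine Set.Subset.antisymm (fun g hg => ?_) (by rintro _ ⟨x, rfl⟩; exact hf x)
  refine G.mem_of_isClosed_of_forall_mem_map a.hom.toMonoidHom.range
    (isCompact_range a.hom.continuous_toFun).isClosed g fun U => ?_
  set S := a.hom.toMonoidHom.range.map (QuotientGroup.mk' U.toSubgroup)
  have := Fintype.ofFinite S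
  set N := MonoidAlgebra.subgroupSum R S
  have hNa (x : H) : N * π U (a x) = N :=
    MonoidAlgebra.subgroupSum_mul_of S ⟨a x, ⟨x, rfl⟩, rfl⟩
  have hNE : N * proj R G U E = Nat.card K • N := by
    have h (k : K) : N * proj R G U (of R G (a (i k))) = N := hNa (i k)
    rw [map_sum, Finset.mul_sum, Finset.sum_congr rfl fun k _ => h k, Finset.sum_const,
      Finset.card_univ, Nat.card_eq_fintype_card]
  -- Left multiplication by `N` preserves right derivations, so the two sides need only be compared
  -- on `H` and `L`.
  have key : N * F U g = Nat.card K • (N * (π U g - 1)) := by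
    refine hG.derivation_ext (π U) (f := fun g => N * F U g)
      (f' := fun g => Nat.card K • (N * (π U g - 1)))
      (continuous_of_discreteTopology.comp (hFc U))
      ((continuous_of_discreteTopology (f := fun x => Nat.card K • (N * (x - 1)))).comp (hπ U))
      (fun x y => ?_) (fun x y => ?_) (fun x => ?_) (fun x => ?_) g
    · rw [hF, mul_add, mul_assoc]
    · rw [smul_mul_assoc, ← smul_add, map_mul]
      congr 1
      noncomm_ring
    · rw [hFa, mul_sub, hNa, mul_one, sub_self, mul_zero, smul_zero]
    · rw [hFb, ← mul_assoc, hNE, smul_mul_assoc]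
  have hFg : F U g = 0 := congrArg (proj R G U) hg
  rw [hFg, mul_zero] at key
  exact MonoidAlgebra.mem_of_nsmul_subgroupSum_mul_eq_zero S hR key.symm
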